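/- Let $N$ be a finite set of agents and $\mathcal O$ a finite nonempty set of objects. An allocation is a map $x:N\to\mathcal O$, $i\mapsto x_i$; a constraint is a nonempty set $C\subseteq\mathcal O^N$ of allocations, called feasible. For allocations $x,y$ put $d(x,y)=\{i\in N: x_i\neq y_i\}$. A preference profile $\succ=(\succ_i)_{i\in N}$ consists of a strict total order $\succ_i$ on $\mathcal O$ for each agent $i$; $a\succsim_i b$ means $a\succ_i b$ or $a=b$. A local compromiser assignment for $C$ is a map $\alpha:\mathcal O^N\to 2^N$ with $\alpha(x)\neq\emptyset$ for every $x\notin C$ and $\alpha(x)=\emptyset$ for every $x\in C$. The local priority algorithm for $\alpha$ at a profile $\succ$ starts at the allocation $x^0$ in which every agent gets her most preferred object. If the current allocation $x^t$ is feasible, it stops and returns $x^t$. If $x^t$ is infeasible and some $k\in\alpha(x^t)$ has no object strictly worse than $x^t_k$, it stops and fails. Otherwise $x^{t+1}_k$ is, for each $k\in\alpha(x^t)$, the $\succ_k$-best object strictly worse than $x^t_k$, and $x^{t+1}_j=x^t_j$ for $j\notin\alpha(x^t)$. If the algorithm returns a feasible allocation at every profile, $\alpha$ is called implementable, and $LP_\alpha(\succ)$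 denotes the allocation returned at $\succ$. The assignment $\alpha$ is forward consistent if $d(x,y)\subseteq\alpha(x)$ implies $\alpha(x)\setminus d(x,y)\subseteq\alpha(y)$ for all allocations $x,y$. Infeasible allocations $x,y$ are $i$-connected under $\alpha$ if there are $p\ge 2$ and allocations $z^1,\dots,z^p$ with $z^1=x$, $z^p=y$, $d(z^1,z^2)=\{i\}$ and $d(z^l,z^{l+1})\subseteq\alpha(z^l)$ for all $l<p$, such that for no agent $j$ are there $r<s<t$ with $z^r_j=z^t_j\neq z^s_j$. The assignment $\alpha$ is backward consistent if, for every agent $i$ and all infeasible $x,y$ that are $i$-connected under $\alpha$, every allocation $x'$ with $d(x,x')\subseteq\alpha(y)$ and $i\notin d(x,x')$ satisfies $i\in\alpha(x')$. It is consistent if it is both forward and backward consistent. Proposition. Fix a constraint $C$ and an agent $i$. Let $\alpha$ and $\alpha'$ be two consistent, implementable local compromiser assignments for $C$ such that for every infeasible $x$: (1) for every $j\neq i$, if $j\in\alpha(x)$ then $j\in\alpha'(x)$; (2) if $i\in\alpha'(x)$ then $i\in\alpha(x)$. Then $LP_{\alpha'}(\succ)_i\succsim_i LP_\alpha(\succ)_i$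 for every preference profile $\succ$. -/

import Mathlib

namespace LocalPriority

/-- A strict preference on the set of objects `O`; `P.gt a b` means that `a` is ranked above `b`. -/
structure Preference (O : Type*) where
  gt : O → O → Prop
  isStrictTotalOrder : IsStrictTotalOrder O gt

namespace Preference

variable {O : Type*}

/-- Weak preference: `a` is ranked above `b`, or `a = b`. -/
def ge (P : Preference O) (a b : O) : Prop := P.gt a b ∨ a = b

/-- The strict lower contour set of `a`. -/
def lowerContour (P : Preference O) (a : O) : Set O := {b | P.gt a b}

/-- `a` is the most preferred element of `S`. -/
def IsBest (P : Preference O) (S : Set O) (a : O) : Prop :=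
  a ∈ S ∧ ∀ b ∈ S, P.ge a b

theorem exists_isBest [Finite O] (P : Preference O) {S : Set O} (hS : S.Nonempty) :
    ∃ a, P.IsBest S a := by
  have := P.isStrictTotalOrder
  have hwf : WellFounded P.gt := Finite.wellFounded_of_trans_of_irrefl P.gt
  refine ⟨hwf.min S hS, hwf.min_mem S hS, fun b hb => ?_⟩
  rcases trichotomous_of P.gt (hwf.min S hS) b with h | h | h
  · exact Or.inl h
  · exact Or.inr h
  · exact absurd h (hwf.not_lt_min S hb)

/-- The most preferred element of a nonempty set of objects. -/
noncomputable def argmax [Finite O] (P : Preference O) (S : Set O) (hS : S.Nonempty) : O :=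
  (P.exists_isBest hS).choose

end Preference

/-- An allocation gives every agent in `N` an object in `O`. -/
abbrev Allocation (N O : Type*) := N → O

/-- A preference profile gives every agent a strict preference over objects. -/
abbrev Profile (N O : Type*) := N → Preference O

variable {N O : Type*}

/-- The set of agents whose objects differ in `x` and `y`. -/
def diff (x y : Allocation N O) : Set N := {i | x i ≠ y i}

/-- `α` is a local compromiser assignment for the constraint `C` (the set of feasible
allocations): nonempty at every infeasible allocation, empty at every feasible one. -/
structure IsLocalCompromiserAssignment (C : Set (Allocation N O))
    (α : Allocation N O → Set N) : Prop where
  nonempty_of_infeasible : ∀ x, x ∉ C → (α x).Nonempty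
  eq_empty_of_feasible : ∀ x, x ∈ C → α x = ∅

open Classical in
/-- One update from an infeasible allocation `x`: every compromiser moves to her best object
strictly below the current one; the value is `none` if some compromiser has no such object. -/
noncomputable def update [Finite O] (α : Allocation N O → Set N) (P : Profile N O)
    (x : Allocation N O) : Option (Allocation N O) :=
  if h : ∀ k ∈ α x, ((P k).lowerContour (x k)).Nonempty then
    some fun j => if hj : j ∈ α x then (P j).argmax ((P j).lowerContour (x j)) (h j hj) else x j
  else none

open Classical in
/-- The state of the local priority algorithm after `t` updates. It starts at the allocation of
top choices and stays put once it is feasible; `none` is the failure symbol. -/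
noncomputable def run [Finite O] [Nonempty O] (C : Set (Allocation N O))
    (α : Allocation N O → Set N) (P : Profile N O) : ℕ → Option (Allocation N O)
  | 0 => some fun j => (P j).argmax Set.univ Set.univ_nonempty
  | t + 1 => (run C α P t).bind fun x => if x ∈ C then some x else update α P x

/-- The local priority algorithm at profile `P` stops and returns the feasible allocation `x`. -/
def Returns [Finite O] [Nonempty O] (C : Set (Allocation N O))
    (α : Allocation N O → Set N) (P : Profile N O) (x : Allocation N O) : Prop :=
  x ∈ C ∧ ∃ t, run C α P t = some x

/-- The local priority algorithm returns an allocation at every preference profile. -/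
def Implementable [Finite O] [Nonempty O] (C : Set (Allocation N O))
    (α : Allocation N O → Set N) : Prop :=
  ∀ P : Profile N O, ∃ x, Returns C α P x

/-- The local priority mechanism of an implementable assignment. -/
noncomputable def LP [Finite O] [Nonempty O] {C : Set (Allocation N O)}
    {α : Allocation N O → Set N} (h : Implementable C α) (P : Profile N O) : Allocation N O :=
  (h P).choose

def ForwardConsistent (α : Allocation N O → Set N) : Prop :=
  ∀ x y, diff x y ⊆ α x → α x \ diff x y ⊆ α y

/-- The sequence of objects `a 0, …, a p` never leaves an object and returns to it. -/
def AcyclicObjects (p : ℕ) (a : ℕ → O) : Prop :=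
  ¬ ∃ r s t, r < s ∧ s < t ∧ t ≤ p ∧ a r = a t ∧ a s ≠ a r

/-- The sequence of allocations `z 0, …, z p` is acyclic for every agent. -/
def AcyclicAllocations (p : ℕ) (z : ℕ → Allocation N O) : Prop :=
  ∀ j, AcyclicObjects p fun l => z l j

/-- `x` and `y` are `i`-connected under `α`, through the sequence `z 0, …, z p` with `1 ≤ p`. -/
def Connected (α : Allocation N O → Set N) (i : N) (x y : Allocation N O) : Prop :=
  ∃ (p : ℕ) (z : ℕ → Allocation N O), 1 ≤ p ∧ AcyclicAllocations p z ∧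
    z 0 = x ∧ z p = y ∧ diff (z 0) (z 1) = {i} ∧
    ∀ l < p, diff (z (l + 1)) (z l) ⊆ α (z l)

def BackwardConsistent (C : Set (Allocation N O)) (α : Allocation N O → Set N) : Prop :=
  ∀ i x y, x ∉ C → y ∉ C → Connected α i x y →
    ∀ x', diff x x' ⊆ α y → i ∉ diff x x' → i ∈ α x'

def Consistent (C : Set (Allocation N O)) (α : Allocation N O → Set N) : Prop :=
  ForwardConsistent α ∧ BackwardConsistent C α

end LocalPriority

/-! Each round of the algorithm splits into single moves (`Step`). Forward consistency makes these
confluent, and feasible allocations are terminal, so the order of moves is irrelevant. Backward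
consistency then gives the key fact `LP_ne_of_reflTransGen_step`: once `i` compromises on an object,
no report of hers against the same others obtains it. Suppose `i` strictly prefers her `α`-object
`a` to her `α'`-object, and let her promote `a` to the top. By the key fact for `α` she still gets
`a`, hence never moves; the others' moves are also legal under `α'`, so `α'` reaches the same
feasible allocation at the new report. But her `α'`-run at the original report passes below `a`, so
she compromises on `a` there, and the key fact for `α'` is contradicted. -/

namespace LocalPriority

/-! ### Strict preferences and promotion of an object. -/

namespace Preference

variable {O : Type*} (P : Preference O)

theorem gt_irrefl (a : O) : ¬ P.gt a a :=
  have := P.isStrictTotalOrder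
  irrefl_of P.gt a

theorem gt_trans {a b c : O} (hab : P.gt a b) (hbc : P.gt b c) : P.gt a c :=
  have := P.isStrictTotalOrder
  trans_of P.gt hab hbc

theorem ge_refl (a : O) : P.ge a a := Or.inr rfl

theorem ge_trans {a b c : O} (hab : P.ge a b) (hbc : P.ge b c) : P.ge a c := by
  rcases hab with hab | rfl
  · rcases hbc with hbc | rfl
    · exact Or.inl (P.gt_trans hab hbc)
    · exact Or.inl hab
  · exact hbc

theorem ge_antisymm {a b : O} (hab : P.ge a b) (hba : P.ge b a) : a = b := by
  rcases hab with hab | rfl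
  · rcases hba with hba | rfl
    · exact absurd (P.gt_trans hab hba) (P.gt_irrefl a)
    · rfl
  · rfl

theorem ge_or_gt (a b : O) : P.ge a b ∨ P.gt b a := by
  have := P.isStrictTotalOrder
  rcases trichotomous_of P.gt a b with h | h | h
  · exact Or.inl (Or.inl h)
  · exact Or.inl (Or.inr h)
  · exact Or.inr h

theorem not_ge_of_gt {a b : O} (h : P.gt a b) : ¬ P.ge b a := by
  rintro (h' | rfl)
  · exact P.gt_irrefl a (P.gt_trans h h')
  · exact P.gt_irrefl _ h

theorem IsBest.unique {P : Preference O} {S : Set O} {a b : O}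
    (ha : P.IsBest S a) (hb : P.IsBest S b) : a = b :=
  P.ge_antisymm (ha.2 b hb.1) (hb.2 a ha.1)

theorem isBest_argmax [Finite O] {S : Set O} (hS : S.Nonempty) :
    P.IsBest S (P.argmax S hS) :=
  (P.exists_isBest hS).choose_spec

/-- The preference that ranks `a` first and agrees with `P` on the other objects. -/
def promote (a : O) : Preference O where
  gt b c := c ≠ a ∧ (b = a ∨ P.gt b c)
  isStrictTotalOrder :=
    { irrefl := fun b h => h.2.elim h.1 (P.gt_irrefl b)
      trans := fun b c d hbc hcd => ⟨hcd.1, hbc.2.imp_right fun h =>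
        P.gt_trans h (hcd.2.resolve_left hbc.1)⟩
      trichotomous := fun b c hbc hcb => by
        rcases P.ge_or_gt b c with (h | h) | h
        · by_cases hc : c = a
          · by_cases hb : b = a
            · rw [hb, hc]
            · exact absurd ⟨hb, Or.inl hc⟩ hcb
          · exact absurd ⟨hc, Or.inr h⟩ hbc
        · exact h
        · by_cases hb : b = a
          · by_cases hc : c = a
            · rw [hb, hc]
            · exact absurd ⟨hc, Or.inl hb⟩ hbc
          · exact absurd ⟨hb, Or.inr h⟩ hcb }

theorem isBest_univ_promote (a : O) : (P.promote a).IsBest Set.univ a := by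
  refine ⟨Set.mem_univ a, fun b _ => ?_⟩
  by_cases hb : b = a
  · exact Or.inr hb.symm
  · exact Or.inl ⟨hb, Or.inl rfl⟩

end Preference

/-! ### Single moves and confluence. -/

open Relation

variable {N O : Type*}

theorem diff_update_subset [DecidableEq N] (x : Allocation N O) (k : N) (b : O) :
    diff x (Function.update x k b) ⊆ {k} := by
  intro j hj
  by_contra hjk
  exact hj (Function.update_of_ne hjk b x).symm

theorem diff_comm (x y : Allocation N O) : diff x y = diff y x :=
  Set.ext fun _ => ne_comm

/-- A single compromiser at `x` moves to her best object below the current one. -/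
def Step [DecidableEq N] (α : Allocation N O → Set N) (P : Profile N O)
    (x y : Allocation N O) : Prop :=
  ∃ k ∈ α x, ∃ b, (P k).IsBest ((P k).lowerContour (x k)) b ∧ y = Function.update x k b

/-- The allocation of top choices. -/
noncomputable def top [Finite O] [Nonempty O] (P : Profile N O) : Allocation N O :=
  fun j => (P j).argmax Set.univ Set.univ_nonempty

theorem top_ge [Finite O] [Nonempty O] (P : Profile N O) (j : N) (a : O) :
    (P j).ge (top P j) a :=
  ((P j).isBest_argmax Set.univ_nonempty).2 a (Set.mem_univ a)

theorem IsLocalCompromiserAssignment.notMem_of_mem {C : Set (Allocation N O)}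
    {α : Allocation N O → Set N} (hα : IsLocalCompromiserAssignment C α) {i : N}
    {x : Allocation N O} (hi : i ∈ α x) : x ∉ C := by
  intro hx
  rw [hα.eq_empty_of_feasible x hx] at hi
  exact hi

theorem LP_mem [Finite O] [Nonempty O] {C : Set (Allocation N O)}
    {α : Allocation N O → Set N} (himp : Implementable C α) (P : Profile N O) :
    LP himp P ∈ C :=
  (himp P).choose_spec.1

section Paths

variable [DecidableEq N] {C : Set (Allocation N O)} {α : Allocation N O → Set N}
  {P Q : Profile N O} {i : N}

theorem Step.ge {x y : Allocation N O} (h : Step α P x y) (j : N) : (P j).ge (x j) (y j) := by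
  obtain ⟨k, -, b, hb, rfl⟩ := h
  by_cases hjk : j = k
  · subst hjk
    rw [Function.update_self]
    exact Or.inl hb.1
  · rw [Function.update_of_ne hjk]
    exact (P j).ge_refl _

theorem ge_of_reflTransGen_step {x y : Allocation N O} (h : ReflTransGen (Step α P) x y)
    (j : N) : (P j).ge (x j) (y j) := by
  induction h with
  | refl => exact (P j).ge_refl _
  | tail _ hs ih => exact (P j).ge_trans ih (hs.ge j)

theorem ForwardConsistent.mem_update (hf : ForwardConsistent α) {x : Allocation N O} {j k : N}
    (hj : j ∈ α x) (hk : k ∈ α x) (hjk : j ≠ k) (b : O) :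
    j ∈ α (Function.update x k b) := by
  have hd := diff_update_subset x k b
  exact hf x _ (hd.trans (Set.singleton_subset_iff.2 hk)) ⟨hj, fun h => hjk (hd h)⟩

/-- Moves of two distinct agents commute: by forward consistency each still compromises after the
other's move. -/
theorem Step.diamond (hf : ForwardConsistent α) {x y z : Allocation N O}
    (hy : Step α P x y) (hz : Step α P x z) :
    ∃ w, ReflGen (Step α P) y w ∧ ReflTransGen (Step α P) z w := by
  obtain ⟨k, hk, b, hb, rfl⟩ := hy
  obtain ⟨l, hl, c, hc, rfl⟩ := hz
  by_cases hkl : k = l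
  · subst hkl
    rw [hb.unique hc]
    exact ⟨_, .refl, .refl⟩
  · refine ⟨Function.update (Function.update x k b) l c, .single ⟨l, ?_, c, ?_, rfl⟩,
      .single ⟨k, ?_, b, ?_, ?_⟩⟩
    · exact hf.mem_update hl hk (Ne.symm hkl) b
    · rwa [Function.update_of_ne (Ne.symm hkl)]
    · exact hf.mem_update hk hl hkl c
    · rwa [Function.update_of_ne hkl]
    · exact Function.update_comm hkl b c x

/-- Whatever order compromisers move in, a feasible allocation reached once stays reachable. -/
theorem reflTransGen_step_of_feasible (hα : IsLocalCompromiserAssignment C α)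
    (hf : ForwardConsistent α) {x y z : Allocation N O} (hz : z ∈ C)
    (hxz : ReflTransGen (Step α P) x z) (hxy : ReflTransGen (Step α P) x y) :
    ReflTransGen (Step α P) y z := by
  obtain ⟨w, hyw, hzw⟩ := church_rosser (fun _ _ _ => Step.diamond hf) hxy hxz
  -- A feasible `z` has no compromiser, so no move leaves it and the common successor is `z` itself.
  rcases hzw.cases_head with rfl | ⟨v, ⟨k, hk, -⟩, -⟩
  · exact hyw
  · exact absurd hz (hα.notMem_of_mem hk)

/-! ### Consequences of backward consistency. -/

theorem connected_update {x : Allocation N O} (hi : i ∈ α x) {c : O} (hc : c ≠ x i) :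
    Connected α i x (Function.update x i c) := by
  have hd : diff x (Function.update x i c) = {i} := by
    refine (diff_update_subset x i c).antisymm (Set.singleton_subset_iff.2 ?_)
    simpa [diff] using hc.symm
  refine ⟨1, fun l => if l = 0 then x else Function.update x i c, le_rfl, ?_, by simp, by simp,
    by simpa using hd, ?_⟩
  · rintro j ⟨r, s, t, hrs, hst, ht, -⟩
    omega
  · intro l hl
    obtain rfl : l = 0 := by omega
    simpa [diff_comm _ x, hd] using hi

/-- An agent who compromises on `a` keeps doing so when the others compromise, whatever object
she currently holds. -/
theorem Step.mem_update_of_mem_update (hα : IsLocalCompromiserAssignment C α)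
    (hcons : Consistent C α) {a : O} {x y : Allocation N O} (h : Step α P x y)
    (hi : i ∈ α (Function.update x i a)) : i ∈ α (Function.update y i a) := by
  obtain ⟨k, hk, b, -, rfl⟩ := h
  by_cases hki : k = i
  · subst hki
    rwa [Function.update_idem]
  rw [Function.update_comm hki]
  by_cases hxa : x i = a
  · subst hxa
    rw [Function.update_eq_self] at hi ⊢
    exact hcons.1.mem_update hi hk (Ne.symm hki) b
  -- Changing only `i`'s object from `a` to `x i` connects to `x`, where `k` compromises; backward
  -- consistency then lets `k` move while `i` holds `a`.
  · have hconn : Connected α i (Function.update x i a) x := by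
      simpa using connected_update hi (c := x i) (by simpa using hxa)
    have hd := diff_update_subset (Function.update x i a) k b
    exact hcons.2 i _ x (hα.notMem_of_mem hi) (hα.notMem_of_mem hk) hconn _
      (hd.trans (Set.singleton_subset_iff.2 hk)) fun h => hki (hd h).symm

theorem mem_update_of_reflTransGen_step (hα : IsLocalCompromiserAssignment C α)
    (hcons : Consistent C α) {a : O} {x y : Allocation N O} (h : ReflTransGen (Step α P) x y)
    (hi : i ∈ α (Function.update x i a)) : i ∈ α (Function.update y i a) := by
  induction h with
  | refl => exact hi
  | tail _ hs ih => exact hs.mem_update_of_mem_update hα hcons ih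

theorem exists_seq_of_reflTransGen {β : Type*} {r : β → β → Prop} {x y : β}
    (h : ReflTransGen r x y) :
    ∃ (n : ℕ) (z : ℕ → β), z 0 = x ∧ z n = y ∧ ∀ l < n, r (z l) (z (l + 1)) := by
  induction h using ReflTransGen.head_induction_on with
  | refl => exact ⟨0, fun _ => y, rfl, rfl, fun l hl => absurd hl (Nat.not_lt_zero l)⟩
  | @head x x' hs _ ih =>
    obtain ⟨n, z, h0, hn, hz⟩ := ih
    refine ⟨n + 1, fun l => l.casesOn x z, rfl, hn, fun l hl => ?_⟩
    cases l with
    | zero => simpa [h0] using hs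
    | succ l => exact hz l (by omega)

/-- The first mover of a path of single moves connects its endpoints. -/
theorem connected_of_step {k : N} {b : O} {x y : Allocation N O} (hk : k ∈ α x)
    (hb : (P k).IsBest ((P k).lowerContour (x k)) b)
    (h : ReflTransGen (Step α P) (Function.update x k b) y) : Connected α k x y := by
  obtain ⟨n, z, h0, hn, hz⟩ := exists_seq_of_reflTransGen h
  have hstep : ∀ l < n + 1, Step α P (Nat.casesOn l x z) (z l) := by
    intro l hl
    cases l with
    | zero => exact ⟨k, hk, b, hb, h0⟩
    | succ l => exact hz l (by omega)
  refine ⟨n + 1, fun l => l.casesOn x z, by omega, ?_, rfl, hn, ?_, ?_⟩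
  · rintro j ⟨r, s, t, hrs, hst, ht, hrt, hsr⟩
    have hmono : ∀ u v, u ≤ v → v ≤ n + 1 →
        (P j).ge ((Nat.casesOn u x z : Allocation N O) j)
          ((Nat.casesOn v x z : Allocation N O) j) := by
      intro u v huv
      induction v, huv using Nat.le_induction with
      | base => exact fun _ => (P j).ge_refl _
      | succ v _ ih =>
        exact fun hv => (P j).ge_trans (ih (by omega)) ((hstep v (by omega)).ge j)
    -- Objects only get worse along a path, so none is left and regained.
    refine hsr ((P j).ge_antisymm ?_ (hmono r s hrs.le (by omega)))
    exact (P j).ge_trans (hmono s t hst.le ht) (Or.inr hrt.symm)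
  · refine Set.Subset.antisymm ?_ (Set.singleton_subset_iff.2 ?_)
    · change diff x (z 0) ⊆ {k}
      rw [h0]
      exact diff_update_subset x k b
    · change x k ≠ z 0 k
      rw [h0, Function.update_self]
      intro hxb
      exact (P k).gt_irrefl b (by simpa [Preference.lowerContour, hxb] using hb.1)
  · intro l hl
    obtain ⟨m, hm, c, -, hc⟩ := hstep l hl
    change diff (z l) _ ⊆ _
    rw [hc, diff_comm]
    exact (diff_update_subset _ m c).trans (Set.singleton_subset_iff.2 hm)

/-- If `i` compromises at the end of a path, then the moves of the other agents along the path
can also be made with `i` holding any fixed object. -/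
theorem reflTransGen_step_update (hα : IsLocalCompromiserAssignment C α)
    (hcons : Consistent C α) (hPQ : ∀ j, j ≠ i → P j = Q j) {x y : Allocation N O}
    (h : ReflTransGen (Step α P) x y) (hi : i ∈ α y) (a : O) :
    ReflTransGen (Step α Q) (Function.update x i a) (Function.update y i a) := by
  induction h using ReflTransGen.head_induction_on with
  | refl => exact .refl
  | @head x x' hs hxy ih =>
    obtain ⟨k, hk, b, hb, rfl⟩ := hs
    by_cases hki : k = i
    · subst hki
      rwa [Function.update_idem] at ih
    · refine .head ⟨k, ?_, b, ?_, Function.update_comm hki b a x⟩ ih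
      -- The rest of the path makes `x` and `y` `k`-connected; since `i` compromises at `y`, her
      -- object at `x` may be replaced without losing `k`.
      · have hd := diff_update_subset x i a
        exact hcons.2 k x y (hα.notMem_of_mem hk) (hα.notMem_of_mem hi)
          (connected_of_step hk hb hxy) _ (hd.trans (Set.singleton_subset_iff.2 hi))
          fun h => hki (hd h)
      · rwa [← hPQ k hki, Function.update_of_ne hki]

/-- A path along which `i` passes from weakly above `a` to strictly below `a` contains an
allocation where `i` holds `a` and compromises. -/
theorem exists_mem_of_gt {a : O} {x y : Allocation N O} (h : ReflTransGen (Step α P) x y)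
    (hx : (P i).ge (x i) a) (hy : (P i).gt a (y i)) :
    ∃ v, ReflTransGen (Step α P) x v ∧ v i = a ∧ i ∈ α v := by
  induction h with
  | refl => exact absurd hx ((P i).not_ge_of_gt hy)
  | @tail y y' hxy hs ih =>
    rcases (P i).ge_or_gt (y i) a with hya | hya
    · obtain ⟨k, hk, b, hb, rfl⟩ := hs
      by_cases hik : i = k
      · subst hik
        rw [Function.update_self] at hy
        rcases hya with hya | hya
        -- A move goes to the next object down, so it cannot jump over `a`.
        · exact absurd (hb.2 a hya) ((P i).not_ge_of_gt hy)
        · exact ⟨y, hxy, hya, hk⟩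
      · rw [Function.update_of_ne hik] at hy
        exact absurd hya ((P i).not_ge_of_gt hy)
    · exact ih hya

/-- A path along which `i` does not move is a path for every assignment that contains all other
compromisers. -/
theorem reflTransGen_step_of_subset {α' : Allocation N O → Set N}
    (hothers : ∀ x j, j ≠ i → j ∈ α x → j ∈ α' x) {x y : Allocation N O}
    (h : ReflTransGen (Step α P) x y) (hxy : x i = y i) : ReflTransGen (Step α' P) x y := by
  induction h using ReflTransGen.head_induction_on with
  | refl => exact .refl
  | @head x x' hs hxy' ih =>
    have hx' : x i = x' i := by
      refine (P i).ge_antisymm (hs.ge i) ?_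
      rw [hxy]
      exact ge_of_reflTransGen_step hxy' i
    refine .head ?_ (ih (hx' ▸ hxy))
    obtain ⟨k, hk, b, hb, rfl⟩ := hs
    refine ⟨k, hothers x k ?_ hk, b, hb, rfl⟩
    rintro rfl
    rw [Function.update_self] at hx'
    exact (P k).gt_irrefl b (by simpa [Preference.lowerContour, hx'] using hb.1)

/-! ### Simultaneous rounds as sequences of single moves. -/

theorem reflTransGen_step_of_update [Finite N] [Finite O] (hf : ForwardConsistent α)
    {x y : Allocation N O} (h : update α P x = some y) : ReflTransGen (Step α P) x y := by
  classical
  unfold update at h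
  split_ifs at h with hne
  obtain rfl := Option.some.inj h
  set y : Allocation N O := fun j =>
    if hj : j ∈ α x then (P j).argmax ((P j).lowerContour (x j)) (hne j hj) else x j with hy
  -- Compromisers move one at a time; forward consistency keeps those outside `S` compromising after
  -- `S` has moved.
  have key : ∀ S : Finset N, ↑S ⊆ α x → ReflTransGen (Step α P) x (S.piecewise y x) := by
    intro S
    induction S using Finset.induction_on with
    | empty => exact fun _ => by simpa using ReflTransGen.refl
    | insert k S hkS ih =>
      intro hS
      have hk : k ∈ α x := hS (Finset.mem_coe.2 (Finset.mem_insert_self k S))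
      have hS' : ↑S ⊆ α x := fun j hj => hS (Finset.mem_coe.2 (Finset.mem_insert_of_mem hj))
      refine (ih hS').tail ⟨k, ?_, y k, ?_, Finset.piecewise_insert _ _ _ _⟩
      · have hd : diff x (S.piecewise y x) ⊆ S := by
          intro j hj
          by_contra hjS
          exact hj (Finset.piecewise_eq_of_notMem S y x hjS).symm
        exact hf x _ (hd.trans hS') ⟨hk, fun h => hkS (hd h)⟩
      · rw [Finset.piecewise_eq_of_notMem S y x hkS, hy]
        simp only [hk, dif_pos]
        exact (P k).isBest_argmax _
  have := key (Set.toFinite (α x)).toFinset (by simp)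
  convert this using 1
  ext j
  by_cases hj : j ∈ α x
  · rw [Finset.piecewise_eq_of_mem _ _ _ (by simpa using hj)]
  · rw [Finset.piecewise_eq_of_notMem _ _ _ (by simpa using hj)]
    simp [hy, hj]

theorem reflTransGen_step_of_run [Finite N] [Finite O] [Nonempty O] (hf : ForwardConsistent α)
    (t : ℕ) {y : Allocation N O} (h : run C α P t = some y) :
    ReflTransGen (Step α P) (top P) y := by
  induction t generalizing y with
  | zero =>
    obtain rfl := Option.some.inj h
    exact .refl
  | succ t ih =>
    rw [run, Option.bind_eq_some_iff] at h
    obtain ⟨x, hx, hxy⟩ := h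
    split_ifs at hxy with hxC
    · obtain rfl := Option.some.inj hxy
      exact ih hx
    · exact (ih hx).trans (reflTransGen_step_of_update hf hxy)

theorem reflTransGen_step_LP [Finite N] [Finite O] [Nonempty O] (hf : ForwardConsistent α)
    (himp : Implementable C α) (P : Profile N O) :
    ReflTransGen (Step α P) (top P) (LP himp P) := by
  obtain ⟨t, ht⟩ := (himp P).choose_spec.2
  exact reflTransGen_step_of_run hf t ht

theorem top_congr [Finite O] [Nonempty O] (hPQ : ∀ j, j ≠ i → P j = Q j) :
    Function.update (top P) i (top Q i) = top Q := by
  ext j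
  by_cases hj : j = i
  · subst hj
    rw [Function.update_self]
  · rw [Function.update_of_ne hj, top, top, hPQ j hj]

/-- If `i` compromises on `a` somewhere along the run at `P`, then no report of `i` against the
same preferences of the others gives her `a`. -/
theorem LP_ne_of_reflTransGen_step [Finite N] [Finite O] [Nonempty O]
    (hα : IsLocalCompromiserAssignment C α) (hcons : Consistent C α)
    (hPQ : ∀ j, j ≠ i → P j = Q j) {v z : Allocation N O}
    (hv : ReflTransGen (Step α P) (top P) v) (hi : i ∈ α v)
    (hz : ReflTransGen (Step α Q) (top Q) z) (hzC : z ∈ C) : z i ≠ v i := by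
  intro hzv
  have hQ := reflTransGen_step_update hα hcons hPQ hv hi (top Q i)
  rw [top_congr hPQ] at hQ
  -- By confluence `z` is still reachable once the others' moves are replayed, and `i`'s compromise
  -- on `v i` persists up to `z`.
  have hmem := mem_update_of_reflTransGen_step hα hcons
    (reflTransGen_step_of_feasible hα hcons.1 hzC hz hQ) (i := i) (a := v i)
    (by simpa using hi)
  rw [← hzv, Function.update_eq_self] at hmem
  exact hα.notMem_of_mem hmem hzC

end Paths

end LocalPriority

open LocalPriority

theorem mainTheorem9 {N O : Type*} [Finite N] [Finite O] [Nonempty O]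
    (C : Set (LocalPriority.Allocation N O)) (hC : C.Nonempty) (i : N)
    (α α' : LocalPriority.Allocation N O → Set N)
    (hα : LocalPriority.IsLocalCompromiserAssignment C α)
    (hα' : LocalPriority.IsLocalCompromiserAssignment C α')
    (hcons : LocalPriority.Consistent C α)
    (hcons' : LocalPriority.Consistent C α')
    (himp : LocalPriority.Implementable C α)
    (himp' : LocalPriority.Implementable C α')
    (hothers : ∀ x, x ∉ C → ∀ j, j ≠ i → j ∈ α x → j ∈ α' x)
    (hself : ∀ x, x ∉ C → i ∈ α' x → i ∈ α x)
    (P : LocalPriority.Profile N O) :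
    (P i).ge (LocalPriority.LP himp' P i) (LocalPriority.LP himp P i) := by
  classical
  refine ((P i).ge_or_gt _ _).resolve_right fun hgt => ?_
  set a := LP himp P i with ha
  let Q : Profile N O := Function.update P i ((P i).promote a)
  have hPQ : ∀ j, j ≠ i → P j = Q j := fun j hj => (Function.update_of_ne hj _ _).symm
  have hbest : (Q i).IsBest Set.univ a := by
    simpa [Q] using (P i).isBest_univ_promote a
  have htop : top Q i = a := ((Q i).isBest_argmax _).unique hbest
  have hz := reflTransGen_step_LP hcons.1 himp Q
  have hza : LP himp Q i = a := by
    rcases hbest.2 (LP himp Q i) (Set.mem_univ _) with h | h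
    -- Otherwise she would compromise on `a` at `Q`, and the report `P i` could not give her `a`.
    · obtain ⟨v, hv, hva, hiv⟩ := exists_mem_of_gt hz (top_ge Q i a) h
      exact absurd (ha.symm.trans hva.symm) (LP_ne_of_reflTransGen_step hα hcons
        (fun j hj => (hPQ j hj).symm) hv hiv (reflTransGen_step_LP hcons.1 himp P)
        (LP_mem himp P))
    · exact h.symm
  -- At `Q` agent `i` starts and ends with `a`, so only others move and `α'` can copy the path.
  have hz' := reflTransGen_step_of_subset
    (fun x j hj hjx => hothers x (hα.notMem_of_mem hjx) j hj hjx) hz (htop.trans hza.symm)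
  obtain ⟨v, hv, hva, hiv⟩ :=
    exists_mem_of_gt (reflTransGen_step_LP hcons'.1 himp' P) (top_ge P i a) hgt
  exact LP_ne_of_reflTransGen_step hα' hcons' hPQ hv hiv hz' (LP_mem himp Q)
    (hza.trans hva.symm)
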